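/- **Setting.** Let $0<p<1$ and let $$\theta_1(z)=2p^{1/4}\sin z\prod_{n\ge1}(1-p^{2n})(1-2p^{2n}\cos 2z+p^{4n}),\qquad \theta_2(z)=2p^{1/4}\cos z\prod_{n\ge1}(1-p^{2n})(1+2p^{2n}\cos 2z+p^{4n}),$$ $$\theta_3(z)=\prod_{n\ge1}(1-p^{2n})(1+2p^{2n-1}\cos 2z+p^{4n-2}),\qquad \theta_4(z)=\prod_{n\ge1}(1-p^{2n})(1-2p^{2n-1}\cos 2z+p^{4n-2})$$ be the Jacobi theta functions of nome $p$. Let $M\in\{0,1,2,\dots\}$ and let $u_r,v_r\in\mathbb R$ ($r=1,\dots,4$) satisfy $u_r>0$ and $|v_r|<u_r+\frac12$ for $r=1,2$. Put $\alpha=\pi/(u_1+u_2+M)$, and let $u\in\mathbb R$ be such that neither $u$ nor $u+1$ lies in $\frac{2\pi}{\alpha}\mathbb Z$. Put $$[z]_1=\frac{\theta_1(\frac\alpha2 z)}{\frac\alpha2\theta_1'(0)},\qquad [z]_r=\frac{\theta_r(\frac\alpha2 z)}{\theta_r(0)}\quad(r=2,3,4),$$ $\pi_1=\mathrm{id}$,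 $\pi_2=(12)(34)$, $\pi_3=(13)(24)$, $\pi_4=(14)(23)$, $$A(z)=\prod_{r=1}^4\frac{[z+u_r]_r}{[z]_r}\frac{[z+\frac12+v_r]_r}{[z+\frac12]_r},\qquad B(z)=\sum_{r=1}^4 c_r\frac{[z+\frac12+u]_r}{[z+\frac12]_r}\frac{[z-\frac12-u]_r}{[z-\frac12]_r},$$ $$c_r=\frac{2}{[u]_1[u+1]_1}\prod_{s=1}^4[u_{\pi_r(s)}-\tfrac12]_s\,[v_{\pi_r(s)}]_s$$ (a summand of $B$ with $c_r=0$ is zero, and if $M=0$ and $B$ has a pole at $u_1$, a summand with a vanishing denominator counts as $0$), and $$a_k=A(-u_1-k),\qquad \tilde a_k=A(u_1+M-k)\quad(1\le k\le M),\qquad b_k=B(u_1+k)\quad(0\le k\le M).$$ Let $\mathbf H$ be the real tridiagonal $(M+1)\times(M+1)$ matrix, with rows and columns numbered from $0$ to $M$, whose entries are $H_{k,k}=b_k$, $H_{k,k+1}=\tilde a_{M-k}$, $H_{k,k-1}=a_k$, and $0$ elsewhere. For $0\le k\le M+1$ let $p_k(x)$ be the leading principal $k\times k$ minor of $x\mathbf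 I-\mathbf H$ (with $p_0=1$), and for $0\le k\le M$ put $$f_k(x)=p_k(x)\prod_{0\le j<k}\tilde a_{M-j}^{-1}.$$ Let $\tilde p_M$ be the polynomial obtained from $p_M$ by the exchange of parameters $(u_1,v_1)\leftrightarrow(u_2,v_2)$, $(u_3,v_3)\leftrightarrow(u_4,v_4)$. **Statement.** The matrix $\mathbf H$ has $M+1$ distinct real eigenvalues $E_0>E_1>\dots>E_M$. Let $\mathbf f(E_j)$ be the column vector with components $f_0(E_j),\dots,f_M(E_j)$, let $\mathbf F=[\mathbf f(E_0),\dots,\mathbf f(E_M)]$, and put $$\Delta_k=\prod_{1\le l\le k}\frac{\tilde a_{M+1-l}}{a_l},\qquad \epsilon_j=\frac{\tilde p_M(E_j)}{a_1\cdots a_M},\qquad N_j=\frac{1}{|\epsilon_j|\,a_1\cdots a_M}\prod_{0\le l\le M,\ l\ne j}|E_j-E_l|$$ for $0\le j,k\le M$, $\mathbf N=\mathrm{diag}(N_0,\dots,N_M)$ and $\boldsymbol\Delta=\mathrm{diag}(\Delta_0,\dots,\Delta_M)$. Then all $N_l$ and all $\Delta_l$ are positive, $\mathbf F$ is invertible,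 and $$\mathbf F^{-1}=\mathbf N^{-1}\mathbf F^T\boldsymbol\Delta,\qquad \det\mathbf F=(-1)^{M(M+1)/2}\prod_{0\le l\le M}\left(\frac{N_l}{\Delta_l}\right)^{1/2}.$$ -/

import Mathlib

noncomputable section

namespace EllipticRacah

/-! The four Jacobi theta functions with nome `p`, for real argument, as infinite products. -/

def theta1 (p z : ℝ) : ℝ :=
  2 * p ^ (1 / 4 : ℝ) * Real.sin z *
    ∏' n : ℕ, ((1 - p ^ (2 * (n + 1))) *
      (1 - 2 * p ^ (2 * (n + 1)) * Real.cos (2 * z) + p ^ (4 * (n + 1))))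

def theta2 (p z : ℝ) : ℝ :=
  2 * p ^ (1 / 4 : ℝ) * Real.cos z *
    ∏' n : ℕ, ((1 - p ^ (2 * (n + 1))) *
      (1 + 2 * p ^ (2 * (n + 1)) * Real.cos (2 * z) + p ^ (4 * (n + 1))))

/-- With `n` starting at `0`, the exponents `2 n + 1`, `4 n + 2` are `2 m - 1`, `4 m - 2` for
`m = n + 1`. -/
def theta3 (p z : ℝ) : ℝ :=
  ∏' n : ℕ, ((1 - p ^ (2 * (n + 1))) *
    (1 + 2 * p ^ (2 * n + 1) * Real.cos (2 * z) + p ^ (4 * n + 2)))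

def theta4 (p z : ℝ) : ℝ :=
  ∏' n : ℕ, ((1 - p ^ (2 * (n + 1))) *
    (1 - 2 * p ^ (2 * n + 1) * Real.cos (2 * z) + p ^ (4 * n + 2)))

/-- The rescaled and normalized theta functions `[z]_r`. The index `r = 1, 2, 3, 4` of the
mathematics is `0, 1, 2, 3 : Fin 4` here, and likewise for all other indices of this kind. -/
def scaledTheta (p α : ℝ) : Fin 4 → ℝ → ℝ :=
  ![fun z => theta1 p (α / 2 * z) / (α / 2 * deriv (theta1 p) 0),
    fun z => theta2 p (α / 2 * z) / theta2 p 0,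
    fun z => theta3 p (α / 2 * z) / theta3 p 0,
    fun z => theta4 p (α / 2 * z) / theta4 p 0]

/-- The permutations `π₁ = id`, `π₂ = (12)(34)`, `π₃ = (13)(24)`, `π₄ = (14)(23)`. -/
def halfPeriodPerm : Fin 4 → Equiv.Perm (Fin 4) :=
  ![1,
    Equiv.swap 0 1 * Equiv.swap 2 3,
    Equiv.swap 0 2 * Equiv.swap 1 3,
    Equiv.swap 0 3 * Equiv.swap 1 2]

/-- The parameters of the finite discrete Heun equation: the elliptic nome `p`, the size
parameter `M`, the coupling parameters `u_r` and `v_r`, and the regularization parameter `w`. -/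
structure HeunParams where
  p : ℝ
  M : ℕ
  u : Fin 4 → ℝ
  v : Fin 4 → ℝ
  w : ℝ

namespace HeunParams

variable (P : HeunParams)

/-- The scaling parameter `α = π / (u₁ + u₂ + M)`. -/
def alpha : ℝ := Real.pi / (P.u 0 + P.u 1 + P.M)

/-- `P.br r z` is `[z]_r`. -/
def br (r : Fin 4) (z : ℝ) : ℝ := scaledTheta P.p P.alpha r z

/-- The standing restrictions on the parameters. The last two conditions say that neither `w` nor
`w + 1` is congruent to `0` modulo the real period `2 π / α`. -/
structure Admissible : Prop where
  p_pos : 0 < P.p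
  p_lt_one : P.p < 1
  u1_pos : 0 < P.u 0
  u2_pos : 0 < P.u 1
  v1_lt : |P.v 0| < P.u 0 + 1 / 2
  v2_lt : |P.v 1| < P.u 1 + 1 / 2
  w_ne : ∀ n : ℤ, P.w ≠ n * (2 * Real.pi / P.alpha)
  w_add_one_ne : ∀ n : ℤ, P.w + 1 ≠ n * (2 * Real.pi / P.alpha)

/-- The coefficient `A(z)` of the difference Heun operator. -/
def coeffA (z : ℝ) : ℝ :=
  ∏ r : Fin 4, (P.br r (z + P.u r) / P.br r z) *
    (P.br r (z + 1 / 2 + P.v r) / P.br r (z + 1 / 2))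

/-- The constants `c_r`. -/
def c (r : Fin 4) : ℝ :=
  2 / (P.br 0 P.w * P.br 0 (P.w + 1)) *
    ∏ s : Fin 4, (P.br s (P.u (halfPeriodPerm r s) - 1 / 2) * P.br s (P.v (halfPeriodPerm r s)))

/-- The coefficient `B(z)` of the difference Heun operator. -/
def coeffB (z : ℝ) : ℝ :=
  ∑ r : Fin 4, P.c r * (P.br r (z + 1 / 2 + P.w) / P.br r (z + 1 / 2)) *
    (P.br r (z - 1 / 2 - P.w) / P.br r (z - 1 / 2))

/-- `a_k = A(-u₁ - k)`. -/
def a (k : ℕ) : ℝ := P.coeffA (-P.u 0 - k)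

/-- `ã_k = A(u₁ + M - k)`. -/
def aTilde (k : ℕ) : ℝ := P.coeffA (P.u 0 + P.M - k)

/-- `b_k = B(u₁ + k)`. -/
def b (k : ℕ) : ℝ := P.coeffB (P.u 0 + k)

/-- The entry in row `j` and column `k` (counted from `0`) of the tridiagonal matrix `H`. -/
def entry (j k : ℕ) : ℝ :=
  if j = k then P.b j
  else if k = j + 1 then P.aTilde (P.M - j)
  else if j = k + 1 then P.a j
  else 0

/-- The tridiagonal matrix `H` of the finite discrete Heun equation. -/
def H : Matrix (Fin (P.M + 1)) (Fin (P.M + 1)) ℝ :=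
  Matrix.of fun j k => P.entry j k

/-- The monic elliptic Racah polynomial `p_k(x)`: the leading principal minor of size `k` of
`x I - H` (equal to `1` for `k = 0`). -/
def racah (k : ℕ) (x : ℝ) : ℝ :=
  (Matrix.of fun i j : Fin k => (if i = j then x else 0) - P.entry i j).det

/-- The normalized elliptic Racah polynomials `f_k(x)`. -/
def f (k : ℕ) (x : ℝ) : ℝ :=
  P.racah k x * ∏ j ∈ Finset.range k, (P.aTilde (P.M - j))⁻¹

/-- The parameters acted on by `π₂`, that is, `u₁ ↔ u₂`, `u₃ ↔ u₄`, `v₁ ↔ v₂`, `v₃ ↔ v₄`. -/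
def perm2 : HeunParams :=
  { P with
    u := fun r => P.u (halfPeriodPerm 1 r)
    v := fun r => P.v (halfPeriodPerm 1 r) }

/-- `E₀ > E₁ > ⋯ > E_M` is the complete list of the eigenvalues of `H`. -/
def IsOrderedSpectrum (E : Fin (P.M + 1) → ℝ) : Prop :=
  StrictAnti E ∧ Set.range E = spectrum ℝ P.H

/-- The matrix `F` with columns `f(E₀), …, f(E_M)`. -/
def F (E : Fin (P.M + 1) → ℝ) : Matrix (Fin (P.M + 1)) (Fin (P.M + 1)) ℝ :=
  Matrix.of fun k j => P.f k (E j)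

/-- The orthogonality weights `Δ_k`. -/
def weight (k : ℕ) : ℝ :=
  ∏ l ∈ Finset.Icc 1 k, P.aTilde (P.M + 1 - l) / P.a l

/-- `ε_j`, where the polynomial in the numerator is the one with permuted parameters. -/
def eps (E : Fin (P.M + 1) → ℝ) (j : Fin (P.M + 1)) : ℝ :=
  P.perm2.racah P.M (E j) / ∏ k ∈ Finset.Icc 1 P.M, P.a k

/-- The quadratic norms `N_j`. -/
def norm (E : Fin (P.M + 1) → ℝ) (j : Fin (P.M + 1)) : ℝ :=
  1 / (|P.eps E j| * ∏ k ∈ Finset.Icc 1 P.M, P.a k) *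
    ∏ l ∈ Finset.univ.erase j, |E j - E l|

/-- `diag (N₀, …, N_M)`. -/
def normMatrix (E : Fin (P.M + 1) → ℝ) : Matrix (Fin (P.M + 1)) (Fin (P.M + 1)) ℝ :=
  Matrix.diagonal (P.norm E)

/-- `diag (Δ₀, …, Δ_M)`. -/
def weightMatrix : Matrix (Fin (P.M + 1)) (Fin (P.M + 1)) ℝ :=
  Matrix.diagonal fun k => P.weight k

end HeunParams

end EllipticRacah

end

/-! Positivity of the theta factors makes every off-diagonal entry of `H` positive, so the theorem
is mostly one about Jacobi matrices. The weights satisfy Δ_{k+1} a_{k+1} = Δ_k ã_{M-k}, that is, `H`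
is self-adjoint for the inner product weighted by Δ. It is therefore similar to a symmetric matrix,
and as the three-term recurrence determines an eigenvector by its first entry, the spectrum is real
and simple (`exists_injective_range_eq_spectrum`). The columns of `F` are eigenvectors for distinct
eigenvalues, hence orthogonal: FᵀΔF is diagonal, which gives the inverse.

The squared norms are found by comparing the (0,0) entries of the adjugate of E_j - H and of its
diagonalised form: the minor without row and column 0, times the squared norm, is ∏_{l≠j}(E_j - E_l)
(`det_submatrix_succ_mul_sqNorm`). The only elliptic input besides positivity identifies this minor
with p̃_M(E_j): translation by the half period u₁+u₂+M permutes the theta functions by π₂, so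
exchanging the parameters reverses the order of rows and columns of `H` (`perm2_entry`,
`perm2_racah`).

The determinant gets its modulus from FᵀΔF and its sign from a Vandermonde product. -/

namespace EllipticRacah

open Filter Topology

/-! ### Positivity of the theta functions -/

section ThetaProducts

variable {q : ℝ} {x y : ℕ → ℝ}

/-- For |c| ≤ 1 the quadratic lies between (1-y)² and (1+y)², and 1+y ≤ 1/(1-y), so the whole factor
lies between (1-y)³ and (1-y)⁻³. The bound does not involve c, hence serves as a majorant uniform in
the angle. -/
theorem abs_log_thetaFactor_le {x y c : ℝ} (hx : 0 ≤ x) (hxy : x ≤ y) (hy : y < 1)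
    (hc : |c| ≤ 1) :
    0 < (1 - x) * (1 + 2 * y * c + y ^ 2) ∧
      |Real.log ((1 - x) * (1 + 2 * y * c + y ^ 2))| ≤ -3 * Real.log (1 - y) := by
  obtain ⟨hc1, hc2⟩ := abs_le.1 hc
  have hy0 : 0 ≤ y := hx.trans hxy
  have h1y : 0 < 1 - y := by linarith
  have hlow : (1 - y) ^ 2 ≤ 1 + 2 * y * c + y ^ 2 := by nlinarith
  have hup : 1 + 2 * y * c + y ^ 2 ≤ (1 + y) ^ 2 := by nlinarith
  have hlow' : (1 - y) ^ 3 ≤ (1 - x) * (1 + 2 * y * c + y ^ 2) := by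
    calc (1 - y) ^ 3 = (1 - y) * (1 - y) ^ 2 := by ring
      _ ≤ _ := mul_le_mul (by linarith) hlow (by positivity) (by linarith)
  have hpos : 0 < (1 - x) * (1 + 2 * y * c + y ^ 2) := lt_of_lt_of_le (by positivity) hlow'
  have hinv : 1 + y ≤ (1 - y)⁻¹ := by
    rw [← one_div, le_div_iff₀ h1y]; nlinarith
  have hup' : (1 - x) * (1 + 2 * y * c + y ^ 2) ≤ ((1 - y)⁻¹) ^ 3 := by
    have h1 : 1 ≤ (1 - y)⁻¹ := by linarith
    calc (1 - x) * (1 + 2 * y * c + y ^ 2) ≤ 1 * (1 + y) ^ 2 :=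
          mul_le_mul (by linarith) hup ((by positivity : 0 ≤ (1 - y) ^ 2).trans hlow) (by norm_num)
      _ = (1 + y) ^ 2 := one_mul _
      _ ≤ ((1 - y)⁻¹) ^ 2 := by gcongr
      _ ≤ ((1 - y)⁻¹) ^ 3 := pow_le_pow_right₀ h1 (by norm_num)
  refine ⟨hpos, abs_le.2 ⟨?_, ?_⟩⟩
  · have := Real.log_le_log (by positivity) hlow'
    rw [Real.log_pow] at this
    push_cast at this
    linarith
  · have := Real.log_le_log hpos hup'
    rw [Real.log_pow, Real.log_inv] at this
    push_cast at this
    linarith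

/-- Infinite products of theta type are positive and continuous in the angular variable. -/
theorem thetaProduct_pos_continuous (hq0 : 0 < q) (hq1 : q < 1) (hx : ∀ n, 0 ≤ x n)
    (hxy : ∀ n, x n ≤ y n) (hy : ∀ n, y n ≤ q ^ (n + 1)) {c : ℝ → ℝ} (hc : Continuous c)
    (hc1 : ∀ z, |c z| ≤ 1) :
    (∀ z, 0 < ∏' n, ((1 - x n) * (1 + 2 * y n * c z + y n ^ 2))) ∧
      Continuous fun z => ∏' n, ((1 - x n) * (1 + 2 * y n * c z + y n ^ 2)) := by
  have hqn : ∀ n : ℕ, q ^ (n + 1) < 1 := fun n => pow_lt_one₀ hq0.le hq1 n.succ_ne_zero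
  have hyn : ∀ n, y n < 1 := fun n => (hy n).trans_lt (hqn n)
  have key := fun n z => abs_log_thetaFactor_le (hx n) (hxy n) (hyn n) (hc1 z)
  have hsum : Summable fun n : ℕ => -3 * Real.log (1 - q ^ (n + 1)) := by
    have h : Summable fun n : ℕ => -q ^ (n + 1) :=
      ((summable_nat_add_iff 1).2 (summable_geometric_of_lt_one hq0.le hq1)).neg
    exact (Real.summable_log_one_add_of_summable h).mul_left (-3)
  have hbound : ∀ n z, ‖Real.log ((1 - x n) * (1 + 2 * y n * c z + y n ^ 2))‖ ≤
      -3 * Real.log (1 - q ^ (n + 1)) := fun n z => by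
    have := Real.log_le_log (by linarith [hqn n]) (sub_le_sub_left (hy n) 1)
    exact (key n z).2.trans (by linarith)
  -- The product is the exponential of a uniformly convergent series of logarithms, which yields
  -- positivity and continuity at once.
  have hexp : ∀ z, ∏' n, ((1 - x n) * (1 + 2 * y n * c z + y n ^ 2)) =
      Real.exp (∑' n, Real.log ((1 - x n) * (1 + 2 * y n * c z + y n ^ 2))) := fun z =>
    (Real.rexp_tsum_eq_tprod (fun n => (key n z).1)
      (.of_norm_bounded hsum fun n => hbound n z)).symm
  refine ⟨fun z => hexp z ▸ Real.exp_pos _, ?_⟩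
  simp_rw [hexp]
  refine Real.continuous_exp.comp (continuous_tsum (fun n => ?_) hsum hbound)
  exact Continuous.log (by fun_prop) fun z => (key n z).1.ne'

end ThetaProducts

section Theta

variable {p : ℝ}

theorem theta1_product (h0 : 0 < p) (h1 : p < 1) :
    (∀ z : ℝ, 0 < ∏' n : ℕ, ((1 - p ^ (2 * (n + 1))) *
      (1 - 2 * p ^ (2 * (n + 1)) * Real.cos (2 * z) + p ^ (4 * (n + 1))))) ∧
    Continuous fun z : ℝ => ∏' n : ℕ, ((1 - p ^ (2 * (n + 1))) *
      (1 - 2 * p ^ (2 * (n + 1)) * Real.cos (2 * z) + p ^ (4 * (n + 1)))) := by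
  convert thetaProduct_pos_continuous h0 h1 (x := fun n => p ^ (2 * (n + 1)))
    (y := fun n => p ^ (2 * (n + 1))) (fun n => by positivity) (fun n => le_rfl)
    (fun n => pow_le_pow_of_le_one h0.le h1.le (by omega))
    (c := fun z => -Real.cos (2 * z)) (by fun_prop)
    (fun z => by rw [abs_neg]; exact Real.abs_cos_le_one _) using 6 <;> ring

theorem theta1_pos (h0 : 0 < p) (h1 : p < 1) {z : ℝ} (hz0 : 0 < z) (hz : z < Real.pi) :
    0 < theta1 p z :=
  mul_pos (mul_pos (by positivity) (Real.sin_pos_of_pos_of_lt_pi hz0 hz))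
    ((theta1_product h0 h1).1 z)

/-- Since sin vanishes at 0, the difference quotient there is that of sin times the infinite
product, so continuity of the product suffices and its derivative is never needed. -/
theorem deriv_theta1_zero_ne_zero (h0 : 0 < p) (h1 : p < 1) : deriv (theta1 p) 0 ≠ 0 := by
  obtain ⟨hpos, hcont⟩ := theta1_product h0 h1
  set G : ℝ → ℝ := fun z => ∏' n : ℕ, ((1 - p ^ (2 * (n + 1))) *
      (1 - 2 * p ^ (2 * (n + 1)) * Real.cos (2 * z) + p ^ (4 * (n + 1)))) with hG
  have h : HasDerivAt (theta1 p) (2 * p ^ (1 / 4 : ℝ) * G 0) 0 := by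
    rw [hasDerivAt_iff_tendsto_slope]
    have hsin := (hasDerivAt_iff_tendsto_slope.1 (Real.hasDerivAt_sin 0))
    have hGt : Tendsto G (𝓝[≠] 0) (𝓝 (G 0)) := (hcont.tendsto 0).mono_left nhdsWithin_le_nhds
    have := (hsin.const_mul (2 * p ^ (1 / 4 : ℝ))).mul hGt
    rw [Real.cos_zero, mul_one] at this
    refine this.congr fun z => ?_
    simp only [slope_def_field, theta1, Real.sin_zero, mul_zero, zero_mul, sub_zero, hG]
    ring
  rw [h.deriv]
  exact (mul_pos (by positivity) (hpos 0)).ne'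

theorem theta2_pos (h0 : 0 < p) (h1 : p < 1) {z : ℝ}
    (hz0 : -(Real.pi / 2) < z) (hz : z < Real.pi / 2) :
    0 < theta2 p z := by
  refine mul_pos (mul_pos (by positivity) (Real.cos_pos_of_mem_Ioo ⟨hz0, hz⟩)) ?_
  refine lt_of_lt_of_eq ((thetaProduct_pos_continuous h0 h1 (x := fun n => p ^ (2 * (n + 1)))
    (y := fun n => p ^ (2 * (n + 1))) (fun n => by positivity) (fun n => le_rfl)
    (fun n => pow_le_pow_of_le_one h0.le h1.le (by omega))
    (c := fun z => Real.cos (2 * z)) (by fun_prop)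
    (fun z => Real.abs_cos_le_one _)).1 z) (tprod_congr fun n => ?_)
  ring_nf

theorem theta3_pos (h0 : 0 < p) (h1 : p < 1) (z : ℝ) : 0 < theta3 p z := by
  unfold theta3
  refine lt_of_lt_of_eq ((thetaProduct_pos_continuous h0 h1 (x := fun n => p ^ (2 * (n + 1)))
    (y := fun n => p ^ (2 * n + 1)) (fun n => by positivity)
    (fun n => pow_le_pow_of_le_one h0.le h1.le (by omega))
    (fun n => pow_le_pow_of_le_one h0.le h1.le (by omega))
    (c := fun z => Real.cos (2 * z)) (by fun_prop)
    (fun z => Real.abs_cos_le_one _)).1 z) (tprod_congr fun n => ?_)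
  ring_nf

theorem theta4_pos (h0 : 0 < p) (h1 : p < 1) (z : ℝ) : 0 < theta4 p z := by
  unfold theta4
  refine lt_of_lt_of_eq ((thetaProduct_pos_continuous h0 h1 (x := fun n => p ^ (2 * (n + 1)))
    (y := fun n => p ^ (2 * n + 1)) (fun n => by positivity)
    (fun n => pow_le_pow_of_le_one h0.le h1.le (by omega))
    (fun n => pow_le_pow_of_le_one h0.le h1.le (by omega))
    (c := fun z => -Real.cos (2 * z)) (by fun_prop)
    (fun z => by rw [abs_neg]; exact Real.abs_cos_le_one _)).1 z) (tprod_congr fun n => ?_)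
  ring_nf

end Theta

/-! ### Half-period shifts and parity -/

theorem cos_two_mul_add_half_pi (z : ℝ) :
    Real.cos (2 * (z + Real.pi / 2)) = -Real.cos (2 * z) := by
  rw [show 2 * (z + Real.pi / 2) = 2 * z + Real.pi by ring, Real.cos_add_pi]

theorem theta1_add_half_pi (p z : ℝ) : theta1 p (z + Real.pi / 2) = theta2 p z := by
  simp only [theta1, theta2, cos_two_mul_add_half_pi, Real.sin_add_pi_div_two, mul_neg,
    sub_neg_eq_add]

theorem theta2_add_half_pi (p z : ℝ) : theta2 p (z + Real.pi / 2) = -theta1 p z := by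
  simp only [theta1, theta2, cos_two_mul_add_half_pi, Real.cos_add_pi_div_two, mul_neg, neg_mul,
    ← sub_eq_add_neg]

theorem theta3_add_half_pi (p z : ℝ) : theta3 p (z + Real.pi / 2) = theta4 p z := by
  simp only [theta3, theta4, cos_two_mul_add_half_pi, mul_neg, ← sub_eq_add_neg]

theorem theta4_add_half_pi (p z : ℝ) : theta4 p (z + Real.pi / 2) = theta3 p z := by
  simp only [theta3, theta4, cos_two_mul_add_half_pi, mul_neg, sub_neg_eq_add]

theorem theta1_neg (p z : ℝ) : theta1 p (-z) = -theta1 p z := by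
  simp only [theta1, Real.sin_neg, mul_neg, Real.cos_neg, neg_mul]

theorem theta2_neg (p z : ℝ) : theta2 p (-z) = theta2 p z := by
  simp only [theta2, mul_neg, Real.cos_neg]

theorem theta3_neg (p z : ℝ) : theta3 p (-z) = theta3 p z := by
  simp only [theta3, mul_neg, Real.cos_neg]

theorem theta4_neg (p z : ℝ) : theta4 p (-z) = theta4 p z := by
  simp only [theta4, mul_neg, Real.cos_neg]

namespace HeunParams

/-! ### Ratios of rescaled theta functions -/

/-- The four theta functions as a family. -/
noncomputable def theta (p : ℝ) : Fin 4 → ℝ → ℝ := ![theta1 p, theta2 p, theta3 p, theta4 p]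

variable {P : HeunParams}

/-- The nonzero normalising constants cancel. A vanishing denominator is allowed: both sides are
then 0. Outside the constants c_r, brackets enter A and B only through such ratios. -/
theorem Admissible.br_div_br (hP : P.Admissible) (r : Fin 4) (x y : ℝ) :
    P.br r x / P.br r y = theta P.p r (P.alpha / 2 * x) / theta P.p r (P.alpha / 2 * y) := by
  have hpi := Real.pi_pos
  have hu1 := hP.u1_pos
  have hu2 := hP.u2_pos
  have hα : 0 < P.alpha := by unfold alpha; positivity
  fin_cases r
  · exact div_div_div_cancel_right₀
      (mul_ne_zero (by positivity) (deriv_theta1_zero_ne_zero hP.p_pos hP.p_lt_one)) _ _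
  · exact div_div_div_cancel_right₀
      (theta2_pos hP.p_pos hP.p_lt_one (by linarith) (by linarith)).ne' _ _
  · exact div_div_div_cancel_right₀ (theta3_pos hP.p_pos hP.p_lt_one 0).ne' _ _
  · exact div_div_div_cancel_right₀ (theta4_pos hP.p_pos hP.p_lt_one 0).ne' _ _

/-- A half-period shift permutes the indices of a ratio of theta functions by `π₂`. -/
theorem theta_div_theta_add_half_pi (p : ℝ) (r : Fin 4) (x y : ℝ) :
    theta p r (x + Real.pi / 2) / theta p r (y + Real.pi / 2) =
      theta p (halfPeriodPerm 1 r) x / theta p (halfPeriodPerm 1 r) y := by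
  fin_cases r
  · show theta1 p _ / theta1 p _ = theta2 p _ / theta2 p _
    rw [theta1_add_half_pi, theta1_add_half_pi]
  · show theta2 p _ / theta2 p _ = theta1 p _ / theta1 p _
    rw [theta2_add_half_pi, theta2_add_half_pi, neg_div_neg_eq]
  · show theta3 p _ / theta3 p _ = theta4 p _ / theta4 p _
    rw [theta3_add_half_pi, theta3_add_half_pi]
  · show theta4 p _ / theta4 p _ = theta3 p _ / theta3 p _
    rw [theta4_add_half_pi, theta4_add_half_pi]

theorem theta_neg_div_theta_neg (p : ℝ) (r : Fin 4) (x y : ℝ) :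
    theta p r (-x) / theta p r (-y) = theta p r x / theta p r y := by
  fin_cases r
  · show theta1 p _ / theta1 p _ = theta1 p _ / theta1 p _
    rw [theta1_neg, theta1_neg, neg_div_neg_eq]
  · show theta2 p _ / theta2 p _ = theta2 p _ / theta2 p _
    rw [theta2_neg, theta2_neg]
  · show theta3 p _ / theta3 p _ = theta3 p _ / theta3 p _
    rw [theta3_neg, theta3_neg]
  · show theta4 p _ / theta4 p _ = theta4 p _ / theta4 p _
    rw [theta4_neg, theta4_neg]

theorem Admissible.br_neg_div_br_neg (hP : P.Admissible) (r : Fin 4) (x y : ℝ) :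
    P.br r (-x) / P.br r (-y) = P.br r x / P.br r y := by
  rw [hP.br_div_br, hP.br_div_br, mul_neg, mul_neg, theta_neg_div_theta_neg]

/-- Half of the real period `2 π / α` of the rescaled theta functions. -/
theorem Admissible.pi_div_alpha (hP : P.Admissible) :
    P.alpha / 2 * (P.u 0 + P.u 1 + P.M) = Real.pi / 2 := by
  have hu1 := hP.u1_pos
  have hu2 := hP.u2_pos
  have : P.u 0 + P.u 1 + P.M ≠ 0 := by positivity
  unfold alpha
  field_simp

theorem Admissible.br_div_br_add (hP : P.Admissible) (r : Fin 4) (x y : ℝ) :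
    P.br r (x + (P.u 0 + P.u 1 + P.M)) / P.br r (y + (P.u 0 + P.u 1 + P.M)) =
      P.br (halfPeriodPerm 1 r) x / P.br (halfPeriodPerm 1 r) y := by
  rw [hP.br_div_br, hP.br_div_br, mul_add _ x, mul_add _ y, hP.pi_div_alpha,
    theta_div_theta_add_half_pi]

/-! ### The exchange of parameters -/

theorem halfPeriodPerm_one_apply_apply (r : Fin 4) :
    halfPeriodPerm 1 (halfPeriodPerm 1 r) = r := by
  revert r; decide

/-- The π_r form a Klein four-group in which π_r is the element sending the first index to r. -/
theorem halfPeriodPerm_halfPeriodPerm_one (r s : Fin 4) :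
    halfPeriodPerm 1 (halfPeriodPerm r s) = halfPeriodPerm (halfPeriodPerm 1 r) s := by
  revert r s; decide

theorem perm2_u_zero (P : HeunParams) : P.perm2.u 0 = P.u 1 := rfl

theorem perm2_u_one (P : HeunParams) : P.perm2.u 1 = P.u 0 := rfl

theorem perm2_M (P : HeunParams) : P.perm2.M = P.M := rfl

theorem perm2_perm2 (P : HeunParams) : P.perm2.perm2 = P := by
  simp only [perm2, halfPeriodPerm_one_apply_apply]

theorem perm2_alpha (P : HeunParams) : P.perm2.alpha = P.alpha := by
  unfold alpha
  rw [perm2_u_zero, perm2_u_one, perm2_M, add_comm (P.u 1)]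

theorem perm2_br (P : HeunParams) : P.perm2.br = P.br := by
  funext r z
  unfold br
  rw [perm2_alpha]
  rfl

theorem perm2_c (P : HeunParams) (r : Fin 4) : P.perm2.c r = P.c (halfPeriodPerm 1 r) := by
  simp only [c, perm2_br]
  simp only [perm2, halfPeriodPerm_halfPeriodPerm_one]

theorem Admissible.perm2 (hP : P.Admissible) : P.perm2.Admissible where
  p_pos := hP.p_pos
  p_lt_one := hP.p_lt_one
  u1_pos := hP.u2_pos
  u2_pos := hP.u1_pos
  v1_lt := hP.v2_lt
  v2_lt := hP.v1_lt
  w_ne := P.perm2_alpha ▸ hP.w_ne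
  w_add_one_ne := P.perm2_alpha ▸ hP.w_add_one_ne

/-- The translation relabels the theta functions by the involution π₂; reindexing the product moves
the relabelling onto the parameters. -/
theorem Admissible.coeffA_add (hP : P.Admissible) (z : ℝ) :
    P.coeffA (z + (P.u 0 + P.u 1 + P.M)) = P.perm2.coeffA z := by
  unfold coeffA
  rw [perm2_br, ← Equiv.prod_comp (halfPeriodPerm 1)]
  refine Finset.prod_congr rfl fun r _ => ?_
  rw [add_right_comm z, add_right_comm z _ (1 / 2), add_right_comm (z + 1 / 2), hP.br_div_br_add,
    hP.br_div_br_add, halfPeriodPerm_one_apply_apply]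
  rfl

theorem Admissible.coeffB_add (hP : P.Admissible) (z : ℝ) :
    P.coeffB (z + (P.u 0 + P.u 1 + P.M)) = P.perm2.coeffB z := by
  unfold coeffB
  rw [perm2_br, ← Equiv.sum_comp (halfPeriodPerm 1)]
  refine Finset.sum_congr rfl fun r _ => ?_
  rw [add_right_comm z, add_right_comm (z + 1 / 2), add_sub_right_comm z,
    add_sub_right_comm (z - 1 / 2), mul_div_assoc', mul_div_assoc', mul_div_assoc,
    mul_div_assoc, hP.br_div_br_add, hP.br_div_br_add, halfPeriodPerm_one_apply_apply, perm2_c]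
  rfl

/-- By parity of the theta functions, the reflection swaps the two quotients in each summand. -/
theorem Admissible.coeffB_neg (hP : P.Admissible) (z : ℝ) : P.coeffB (-z) = P.coeffB z := by
  unfold coeffB
  refine Finset.sum_congr rfl fun r _ => ?_
  rw [show -z + 1 / 2 + P.w = -(z - 1 / 2 - P.w) by ring,
    show -z - 1 / 2 - P.w = -(z + 1 / 2 + P.w) by ring,
    show -z + 1 / 2 = -(z - 1 / 2) by ring, show -z - 1 / 2 = -(z + 1 / 2) by ring,
    hP.br_neg_div_br_neg, hP.br_neg_div_br_neg]
  ring

/-- The sample point u₂+M-k is the half-period translate of -u₁-k. -/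
theorem Admissible.perm2_aTilde (hP : P.Admissible) (k : ℕ) : P.perm2.aTilde k = P.a k := by
  have h := hP.perm2.coeffA_add (-P.u 0 - k)
  rw [perm2_perm2, perm2_u_zero, perm2_u_one, perm2_M] at h
  rw [aTilde, a, ← h, perm2_u_zero, perm2_M]
  congr 1
  ring

theorem Admissible.perm2_a (hP : P.Admissible) (k : ℕ) : P.perm2.a k = P.aTilde k := by
  rw [← hP.perm2.perm2_aTilde, perm2_perm2]

/-- The point u₂+k is the half-period translate of -(u₁+M-k); evenness of B removes the sign, whence
the reversal. -/
theorem Admissible.perm2_b (hP : P.Admissible) {k : ℕ} (hk : k ≤ P.M) :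
    P.perm2.b k = P.b (P.M - k) := by
  have h := hP.perm2.coeffB_add (-(P.u 0 + (P.M - k : ℕ)))
  rw [perm2_perm2, perm2_u_zero, perm2_u_one, perm2_M, hP.coeffB_neg] at h
  rw [b, b, ← h, perm2_u_zero]
  congr 1
  push_cast [hk]
  ring

/-- The matrix with exchanged parameters is the reversal of `H`. -/
theorem Admissible.perm2_entry (hP : P.Admissible) {j k : ℕ} (hj : j ≤ P.M) (hk : k ≤ P.M) :
    P.perm2.entry j k = P.entry (P.M - j) (P.M - k) := by
  unfold entry
  rw [perm2_M, hP.perm2_aTilde, hP.perm2_a, hP.perm2_b hj]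
  rcases lt_trichotomy j k with h | h | h
  · rw [if_neg (by omega), if_neg (by omega : ¬ P.M - j = P.M - k),
      if_neg (by omega : ¬ P.M - k = P.M - j + 1), if_neg (by omega : ¬ j = k + 1)]
    simp only [show (k = j + 1) ↔ (P.M - j = P.M - k + 1) by omega]
  · rw [if_pos h, if_pos (by omega)]
  · rw [if_neg (by omega), if_neg (by omega : ¬ P.M - j = P.M - k),
      if_neg (by omega : ¬ k = j + 1), if_neg (by omega : ¬ P.M - j = P.M - k + 1),
      show P.M - (P.M - j) = j by omega]
    simp only [show (j = k + 1) ↔ (P.M - k = P.M - j + 1) by omega]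

/-! ### Positivity of the off-diagonal entries -/

theorem Admissible.br_div_br_pos (hP : P.Admissible) (r : Fin 4) {x y : ℝ}
    (hx : 0 < theta P.p r (P.alpha / 2 * x)) (hy : 0 < theta P.p r (P.alpha / 2 * y)) :
    0 < P.br r x / P.br r y := by
  rw [hP.br_div_br]; exact div_pos hx hy

theorem Admissible.alpha_pos (hP : P.Admissible) : 0 < P.alpha := by
  have hu1 := hP.u1_pos
  have hu2 := hP.u2_pos
  have := Real.pi_pos
  unfold alpha; positivity

theorem Admissible.theta_zero_pos (hP : P.Admissible) {x : ℝ} (h0 : 0 < x)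
    (hx : x < 2 * (P.u 0 + P.u 1 + P.M)) : 0 < theta P.p 0 (P.alpha / 2 * x) := by
  have hα := hP.alpha_pos
  refine theta1_pos hP.p_pos hP.p_lt_one (by positivity) ?_
  have := mul_lt_mul_of_pos_left hx (half_pos hα)
  linarith [hP.pi_div_alpha]

theorem Admissible.theta_one_pos (hP : P.Admissible) {x : ℝ}
    (h0 : -(P.u 0 + P.u 1 + P.M) < x) (hx : x < P.u 0 + P.u 1 + P.M) :
    0 < theta P.p 1 (P.alpha / 2 * x) := by
  have hα := hP.alpha_pos
  have h1 := mul_lt_mul_of_pos_left hx (half_pos hα)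
  have h2 := mul_lt_mul_of_pos_left h0 (half_pos hα)
  have h3 := hP.pi_div_alpha
  exact theta2_pos hP.p_pos hP.p_lt_one (by linarith) (by linarith)

theorem Admissible.a_pos (hP : P.Admissible) {k : ℕ} (hk1 : 1 ≤ k) (hkM : k ≤ P.M) :
    0 < P.a k := by
  have hk1' : (1 : ℝ) ≤ k := Nat.one_le_cast.2 hk1
  have hkM' : (k : ℝ) ≤ P.M := Nat.cast_le.2 hkM
  have hu1 := hP.u1_pos
  have hu2 := hP.u2_pos
  obtain ⟨hv1, hv1'⟩ := abs_lt.1 hP.v1_lt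
  obtain ⟨hv2, hv2'⟩ := abs_lt.1 hP.v2_lt
  unfold a coeffA
  refine Finset.prod_pos fun r _ => ?_
  -- After reflection the arguments of θ₁ fall in (0, π) and those of θ₂ in (-π/2, π/2); the bounds
  -- on v₁ and v₂ are used here. θ₃ and θ₄ are positive everywhere.
  rw [← hP.br_neg_div_br_neg r (-P.u 0 - k + P.u r),
    ← hP.br_neg_div_br_neg r (-P.u 0 - k + 1 / 2 + P.v r)]
  fin_cases r
  · dsimp only [Fin.zero_eta]
    refine mul_pos (hP.br_div_br_pos _ (hP.theta_zero_pos ?_ ?_) (hP.theta_zero_pos ?_ ?_))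
      (hP.br_div_br_pos _ (hP.theta_zero_pos ?_ ?_) (hP.theta_zero_pos ?_ ?_)) <;>
      linarith
  · dsimp only [Fin.mk_one]
    refine mul_pos (hP.br_div_br_pos _ (hP.theta_one_pos ?_ ?_) (hP.theta_one_pos ?_ ?_))
      (hP.br_div_br_pos _ (hP.theta_one_pos ?_ ?_) (hP.theta_one_pos ?_ ?_)) <;>
      linarith
  · have h := theta3_pos hP.p_pos hP.p_lt_one
    exact mul_pos (hP.br_div_br_pos 2 (h _) (h _)) (hP.br_div_br_pos 2 (h _) (h _))
  · have h := theta4_pos hP.p_pos hP.p_lt_one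
    exact mul_pos (hP.br_div_br_pos 3 (h _) (h _)) (hP.br_div_br_pos 3 (h _) (h _))

theorem Admissible.aTilde_pos (hP : P.Admissible) {k : ℕ} (hk1 : 1 ≤ k) (hkM : k ≤ P.M) :
    0 < P.aTilde k :=
  hP.perm2_a k ▸ hP.perm2.a_pos hk1 hkM

end HeunParams

/-! ### Tridiagonal matrices: continuants and the three-term recurrence -/

namespace Tridiagonal

open Finset Matrix

/-- The entries of the tridiagonal matrix with lower diagonal `a`, diagonal `b` and upper
diagonal `c`. -/
def entry (a b c : ℕ → ℝ) (j k : ℕ) : ℝ :=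
  if j = k then b j else if k = j + 1 then c j else if j = k + 1 then a j else 0

/-- The tridiagonal matrix of size `n`. -/
def matrix (a b c : ℕ → ℝ) (n : ℕ) : Matrix (Fin n) (Fin n) ℝ :=
  Matrix.of fun j k => entry a b c j k

/-- The characteristic polynomials of the leading principal blocks. -/
def continuant (a b c : ℕ → ℝ) (k : ℕ) (x : ℝ) : ℝ :=
  (Matrix.of fun i j : Fin k => (if i = j then x else 0) - entry a b c i j).det

/-- The entries of the eigenvector with first entry `1`. -/
noncomputable def eigenvector (a b c : ℕ → ℝ) (k : ℕ) (x : ℝ) : ℝ :=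
  continuant a b c k x * ∏ j ∈ range k, (c j)⁻¹

variable {a b c Δ : ℕ → ℝ} {n : ℕ}

theorem entry_self (k : ℕ) : entry a b c k k = b k := if_pos rfl

theorem entry_succ_left (k : ℕ) : entry a b c (k + 1) k = a (k + 1) := by
  unfold entry
  rw [if_neg (by omega), if_neg (by omega), if_pos rfl]

theorem entry_succ_right (k : ℕ) : entry a b c k (k + 1) = c k := by
  simp [entry]

theorem entry_eq_zero {j k : ℕ} (h : j + 1 < k ∨ k + 1 < j) : entry a b c j k = 0 := by
  unfold entry
  rw [if_neg (by omega), if_neg (by omega), if_neg (by omega)]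

theorem matrix_apply (j k : Fin n) : matrix a b c n j k = entry a b c j k := rfl

theorem sub_matrix_apply (x : ℝ) (i j : Fin n) :
    (scalar (Fin n) x - matrix a b c n) i j = (if i = j then x else 0) - entry a b c i j := by
  rw [Matrix.sub_apply, scalar_apply, diagonal_apply, matrix_apply]

theorem continuant_eq_det (k : ℕ) (x : ℝ) :
    continuant a b c k x = (scalar (Fin k) x - matrix a b c k).det :=
  congrArg det (ext fun i j => (sub_matrix_apply x i j).symm)

theorem continuant_eq_eval_charpoly (k : ℕ) (x : ℝ) :
    continuant a b c k x = (matrix a b c k).charpoly.eval x := by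
  rw [eval_charpoly, continuant_eq_det]

theorem mem_spectrum_iff {x : ℝ} :
    x ∈ spectrum ℝ (matrix a b c n) ↔ continuant a b c n x = 0 := by
  rw [mem_spectrum_iff_isRoot_charpoly, Polynomial.IsRoot.def, continuant_eq_eval_charpoly]

theorem continuant_zero (x : ℝ) : continuant a b c 0 x = 1 := det_isEmpty

theorem continuant_one (x : ℝ) : continuant a b c 1 x = x - b 0 := by
  simp [continuant, entry]

/-- Laplace expansion along the last row leaves two minors; the one that is not a leading block is
expanded along its last column, whose only nonzero entry can be -c_k. -/
theorem continuant_succ_succ (k : ℕ) (x : ℝ) :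
    continuant a b c (k + 2) x =
      (x - b (k + 1)) * continuant a b c (k + 1) x - a (k + 1) * c k * continuant a b c k x := by
  unfold continuant
  rw [det_succ_row _ (Fin.last (k + 1)), Fin.sum_univ_castSucc, Fin.sum_univ_castSucc]
  have h1 : ∀ i : Fin k, (Fin.last k).castSucc.succAbove i.castSucc = i.castSucc.castSucc :=
    fun i => Fin.succAbove_castSucc_of_lt _ _ (Fin.castSucc_lt_last i)
  have h2 : (Fin.last k).castSucc.succAbove (Fin.last k) = Fin.last (k + 1) := by
    rw [Fin.succAbove_castSucc_self, Fin.succ_last]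
  have hzero : ∀ i : Fin k, (Matrix.of fun i j : Fin (k + 2) =>
      (if i = j then x else 0) - entry a b c i j) (Fin.last (k + 1)) i.castSucc.castSucc = 0 := by
    intro i
    rw [of_apply, if_neg (Fin.castSucc_lt_last _).ne', entry_eq_zero, sub_zero]
    right
    simp only [Fin.val_castSucc, Fin.val_last]
    omega
  have hminor : ((Matrix.of fun i j : Fin (k + 2) =>
      (if i = j then x else 0) - entry a b c i j).submatrix (Fin.last (k + 1)).succAbove
        (Fin.last k).castSucc.succAbove).det = -c k * (Matrix.of fun i j : Fin k =>
          (if i = j then x else 0) - entry a b c i j).det := by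
    rw [det_succ_column _ (Fin.last k), Fin.sum_univ_castSucc, Finset.sum_eq_zero, zero_add]
    · congr 1
      · rw [submatrix_apply, h2, Fin.succAbove_last, of_apply, if_neg (Fin.castSucc_lt_last _).ne,
          Fin.val_castSucc, Fin.val_last, Fin.val_last, entry_succ_right, ← two_mul, pow_mul]
        simp
      · congr 1
        ext i j
        simp only [submatrix_apply, Fin.succAbove_last, h1, of_apply, Fin.castSucc_inj,
          Fin.val_castSucc]
    · intro i _
      rw [submatrix_apply, h2, Fin.succAbove_last, of_apply, if_neg (Fin.castSucc_lt_last _).ne,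
        entry_eq_zero, sub_zero, mul_zero, zero_mul]
      left
      simp only [Fin.val_castSucc, Fin.val_last]
      omega
  have hmain : (Matrix.of fun i j : Fin (k + 2) =>
      (if i = j then x else 0) - entry a b c i j).submatrix (Fin.last (k + 1)).succAbove
        (Fin.last (k + 1)).succAbove = Matrix.of fun i j : Fin (k + 1) =>
          (if i = j then x else 0) - entry a b c i j := by
    ext i j
    simp only [submatrix_apply, Fin.succAbove_last, of_apply, Fin.castSucc_inj, Fin.val_castSucc]
  have hodd : (-1 : ℝ) ^ (k + 1 + k) = -1 := Odd.neg_one_pow ⟨k, by ring⟩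
  have heven : (-1 : ℝ) ^ (k + 1 + (k + 1)) = 1 := Even.neg_one_pow ⟨k + 1, rfl⟩
  simp only [hzero, mul_zero, zero_mul, sum_const_zero, zero_add, hminor, hmain, of_apply,
    Fin.val_castSucc, Fin.val_last, entry_self, entry_succ_left, hodd, heven, if_true,
    if_neg (Fin.castSucc_lt_last (Fin.last k)).ne']
  ring

theorem sum_entry_mul (v : ℕ → ℝ) {i : ℕ} (hi : i ≤ n) :
    ∑ k : Fin (n + 1), entry a b c i k * v k =
      (if 0 < i then a i * v (i - 1) else 0) + b i * v i +
        (if i < n then c i * v (i + 1) else 0) := by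
  rw [Fin.sum_univ_eq_sum_range fun k => entry a b c i k * v k]
  -- For i = 0 the truncated index i - 1 is 0 again; the inner condition `0 < i` removes the
  -- spurious term.
  have h : ∀ k, entry a b c i k * v k = (if i - 1 = k then (if 0 < i then a i * v (i - 1) else 0)
      else 0) + (if i = k then b i * v i else 0) +
        (if i + 1 = k then c i * v (i + 1) else 0) := by
    intro k
    unfold entry
    split_ifs <;> first | omega | (subst_vars; simp)
  simp_rw [h]
  rw [sum_add_distrib, sum_add_distrib, sum_ite_eq, sum_ite_eq, sum_ite_eq,
    if_pos (mem_range.2 (by omega : i - 1 < n + 1)),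
    if_pos (mem_range.2 (by omega : i < n + 1))]
  simp only [mem_range, add_lt_add_iff_right]

theorem eigenvector_zero (x : ℝ) : eigenvector a b c 0 x = 1 := by
  rw [eigenvector, continuant_zero, range_zero, prod_empty, mul_one]

theorem mul_eigenvector_succ {k : ℕ} (hk : c k ≠ 0) (x : ℝ) :
    c k * eigenvector a b c (k + 1) x =
      continuant a b c (k + 1) x * ∏ j ∈ range k, (c j)⁻¹ := by
  rw [eigenvector, prod_range_succ]
  field_simp

theorem eigenvector_recurrence_zero (x : ℝ) :
    b 0 * eigenvector a b c 0 x + continuant a b c 1 x = x * eigenvector a b c 0 x := by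
  rw [eigenvector_zero, continuant_one]
  ring

theorem eigenvector_recurrence {k : ℕ} (hk : c k ≠ 0) (x : ℝ) :
    a (k + 1) * eigenvector a b c k x + b (k + 1) * eigenvector a b c (k + 1) x +
      continuant a b c (k + 2) x * ∏ j ∈ range (k + 1), (c j)⁻¹ =
        x * eigenvector a b c (k + 1) x := by
  rw [continuant_succ_succ, eigenvector, eigenvector, prod_range_succ]
  field_simp
  ring

/-- At a root of the characteristic polynomial, `eigenvector` is an eigenvector. -/
theorem sum_entry_mul_eigenvector (hc : ∀ j < n, c j ≠ 0) {x : ℝ}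
    (hx : continuant a b c (n + 1) x = 0) {i : ℕ} (hi : i ≤ n) :
    ∑ k : Fin (n + 1), entry a b c i k * eigenvector a b c k x = x * eigenvector a b c i x := by
  rw [sum_entry_mul (fun k => eigenvector a b c k x) hi]
  have hnext : (if i < n then c i * eigenvector a b c (i + 1) x else 0) =
      continuant a b c (i + 1) x * ∏ j ∈ range i, (c j)⁻¹ := by
    split_ifs with h
    · exact mul_eigenvector_succ (hc i h) x
    · rw [show i = n by omega, hx, zero_mul]
  rw [hnext]
  rcases i with _ | i
  · rw [if_neg (lt_irrefl 0), zero_add, range_zero, prod_empty, mul_one,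
      eigenvector_recurrence_zero]
  · rw [if_pos i.succ_pos, Nat.add_sub_cancel]
    exact eigenvector_recurrence (hc i (by omega)) x

/-- An eigenvector of a tridiagonal matrix with nonvanishing upper diagonal is determined by its
first entry. -/
theorem eq_mul_eigenvector (hc : ∀ j < n, c j ≠ 0) {x : ℝ} {v : ℕ → ℝ}
    (hv : ∀ i ≤ n, ∑ k : Fin (n + 1), entry a b c i k * v k = x * v i) :
    ∀ k ≤ n, v k = v 0 * eigenvector a b c k x := by
  intro k
  induction k using Nat.strong_induction_on with
  | _ k ih =>
    intro hk
    match k, ih, hk with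
    | 0, _, _ => rw [eigenvector_zero, mul_one]
    | 1, ih, hk =>
      have h := hv 0 (Nat.zero_le n)
      rw [sum_entry_mul v (Nat.zero_le n), if_neg (lt_irrefl 0), if_pos (by omega)] at h
      have h1 := eigenvector_recurrence_zero (a := a) (b := b) (c := c) x
      have h2 := mul_eigenvector_succ (a := a) (b := b) (hc 0 (by omega)) x
      rw [range_zero, prod_empty, mul_one] at h2
      rw [eigenvector_zero, ← h2] at h1
      refine mul_left_cancel₀ (hc 0 (by omega)) ?_
      linear_combination h - v 0 * h1
    | k + 2, ih, hk =>
      have h := hv (k + 1) (by omega)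
      rw [sum_entry_mul v (by omega), if_pos (by omega), if_pos (by omega), Nat.add_sub_cancel,
        ih k (by omega) (by omega), ih (k + 1) (by omega) (by omega)] at h
      have h1 := eigenvector_recurrence (a := a) (b := b) (hc k (by omega)) x
      rw [← mul_eigenvector_succ (hc (k + 1) (by omega))] at h1
      refine mul_left_cancel₀ (hc (k + 1) (by omega)) ?_
      linear_combination h - v 0 * h1

/-- Detailed balance: symmetry has to be checked only for neighbouring indices, where it is `hΔ`. -/
theorem weight_mul_entry (hΔ : ∀ k < n, Δ (k + 1) * a (k + 1) = Δ k * c k) {i k : ℕ} (hi : i ≤ n)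
    (hk : k ≤ n) : Δ i * entry a b c i k = Δ k * entry a b c k i := by
  wlog h : i ≤ k generalizing i k
  · exact (this hk hi (by omega)).symm
  rcases h.eq_or_lt with rfl | h
  · rfl
  rcases (Nat.succ_le_of_lt h).eq_or_lt with rfl | h
  · rw [entry_succ_right, entry_succ_left, hΔ i (by omega)]
  · rw [entry_eq_zero (Or.inl h), entry_eq_zero (Or.inr h), mul_zero, mul_zero]

/-! ### Simplicity of the spectrum -/

/-- The spectrum of a symmetrizable tridiagonal matrix consists of as many real numbers as the
matrix has rows. -/
theorem exists_injective_range_eq_spectrum (hc : ∀ j < n, c j ≠ 0) (hpos : ∀ k ≤ n, 0 < Δ k)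
    (hΔ : ∀ k < n, Δ (k + 1) * a (k + 1) = Δ k * c k) :
    ∃ e : Fin (n + 1) → ℝ, Function.Injective e ∧
      Set.range e = spectrum ℝ (matrix a b c (n + 1)) := by
  set D : Fin (n + 1) → ℝ := fun k => √(Δ k) with hD
  have hDpos : ∀ k, 0 < D k := fun k => Real.sqrt_pos.2 (hpos k (by omega))
  have hDD : ∀ k, D k * D k = Δ k := fun k => Real.mul_self_sqrt (hpos k (by omega)).le
  have hunit1 : diagonal D * diagonal (fun k => (D k)⁻¹) = 1 := by
    rw [diagonal_mul_diagonal, ← diagonal_one]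
    exact congrArg diagonal (funext fun k => mul_inv_cancel₀ (hDpos k).ne')
  have hunit2 : diagonal (fun k => (D k)⁻¹) * diagonal D = 1 := by
    rw [diagonal_mul_diagonal, ← diagonal_one]
    exact congrArg diagonal (funext fun k => inv_mul_cancel₀ (hDpos k).ne')
  let U : (Matrix (Fin (n + 1)) (Fin (n + 1)) ℝ)ˣ :=
    ⟨diagonal D, diagonal fun k => (D k)⁻¹, hunit1, hunit2⟩
  -- Conjugation by √Δ symmetrises the matrix, so the spectral theorem applies to `S`.
  set S := diagonal D * matrix a b c (n + 1) * diagonal (fun k => (D k)⁻¹) with hS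
  have hSapply : ∀ i k, S i k = D i * entry a b c i k * (D k)⁻¹ := fun i k => by
    rw [hS, mul_diagonal, diagonal_mul, matrix_apply]
  have hSherm : S.IsHermitian := by
    refine IsHermitian.ext fun i k => ?_
    rw [star_trivial, hSapply, hSapply]
    have h := weight_mul_entry (b := b) hΔ (Nat.le_of_lt_succ i.2) (Nat.le_of_lt_succ k.2)
    rw [← hDD, ← hDD] at h
    have h1 := (hDpos i).ne'
    have h2 := (hDpos k).ne'
    field_simp
    linear_combination -h
  have hspec : spectrum ℝ S = spectrum ℝ (matrix a b c (n + 1)) :=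
    spectrum.units_conjugate (u := U)
  refine ⟨hSherm.eigenvalues, ?_, by rw [← hspec, hSherm.spectrum_real_eq_range_eigenvalues]⟩
  have hform : ∀ i, ∃ s : ℝ, ∀ k, hSherm.eigenvectorBasis i k =
      s * (D k * eigenvector a b c k (hSherm.eigenvalues i)) := by
    intro i
    set v : ℕ → ℝ := fun k => if h : k < n + 1 then
      (D ⟨k, h⟩)⁻¹ * hSherm.eigenvectorBasis i ⟨k, h⟩ else 0 with hv
    have hvk : ∀ k : Fin (n + 1), v k = (D k)⁻¹ * hSherm.eigenvectorBasis i k := fun k => by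
      rw [hv]; exact dif_pos k.2
    have hev := hSherm.mulVec_eigenvectorBasis i
    have := eq_mul_eigenvector (a := a) (b := b) (v := v) (x := hSherm.eigenvalues i) hc
      fun r hr => by
        have h := congrFun hev ⟨r, Nat.lt_succ_of_le hr⟩
        rw [mulVec, dotProduct, Pi.smul_apply, smul_eq_mul] at h
        have hd := hDpos ⟨r, Nat.lt_succ_of_le hr⟩
        have hvr := hvk ⟨r, Nat.lt_succ_of_le hr⟩
        refine mul_left_cancel₀ hd.ne' ?_
        have hvr' : D ⟨r, Nat.lt_succ_of_le hr⟩ * v r =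
            hSherm.eigenvectorBasis i ⟨r, Nat.lt_succ_of_le hr⟩ := by
          rw [show v r = _ from hvr, mul_inv_cancel_left₀ hd.ne']
        rw [mul_left_comm, hvr', ← h, mul_sum]
        refine sum_congr rfl fun k _ => ?_
        rw [hSapply, hvk]
        ring
    refine ⟨v 0, fun k => ?_⟩
    have h := this k (Nat.le_of_lt_succ k.2)
    rw [hvk, inv_mul_eq_iff_eq_mul₀ (hDpos k).ne'] at h
    rw [h]
    ring
  -- A repeated eigenvalue would make two members of the orthonormal basis multiples of the same
  -- vector, contradicting their orthogonality.
  intro i j hij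
  by_contra hne
  obtain ⟨s, hs⟩ := hform i
  obtain ⟨t, ht⟩ := hform j
  have hsij : inner ℝ (hSherm.eigenvectorBasis i) (hSherm.eigenvectorBasis j) = 0 :=
    hSherm.eigenvectorBasis.orthonormal.2 hne
  have hii := hSherm.eigenvectorBasis.orthonormal.1 i
  have hjj := hSherm.eigenvectorBasis.orthonormal.1 j
  have hs0 : s ≠ 0 := by
    rintro rfl
    rw [show hSherm.eigenvectorBasis i = 0 from PiLp.ext fun k => by rw [hs k, zero_mul]; rfl,
      norm_zero] at hii
    exact zero_ne_one hii
  have ht0 : t ≠ 0 := by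
    rintro rfl
    rw [show hSherm.eigenvectorBasis j = 0 from PiLp.ext fun k => by rw [ht k, zero_mul]; rfl,
      norm_zero] at hjj
    exact zero_ne_one hjj
  have hprop : hSherm.eigenvectorBasis j = (t / s) • hSherm.eigenvectorBasis i :=
    PiLp.ext fun k => by
      rw [PiLp.smul_apply, smul_eq_mul, hs k, ht k, hij]
      field_simp
  rw [hprop, inner_smul_right, real_inner_self_eq_norm_sq, hii, one_pow, mul_one] at hsij
  exact div_ne_zero ht0 hs0 hsij

end Tridiagonal

namespace Tridiagonal

open Finset Matrix

variable {a b c Δ : ℕ → ℝ} {n : ℕ} {E : Fin (n + 1) → ℝ}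

/-! ### The matrix of eigenvectors -/

/-- The matrix whose columns are the eigenvectors for the eigenvalues `E`. -/
noncomputable def eigenvectorMatrix (a b c : ℕ → ℝ) (E : Fin (n + 1) → ℝ) :
    Matrix (Fin (n + 1)) (Fin (n + 1)) ℝ :=
  Matrix.of fun k j => eigenvector a b c k (E j)

/-- The square of the weighted norm of the `j`-th eigenvector. -/
noncomputable def sqNorm (a b c Δ : ℕ → ℝ) (E : Fin (n + 1) → ℝ) (j : Fin (n + 1)) : ℝ :=
  ∑ k : Fin (n + 1), Δ k * eigenvector a b c k (E j) ^ 2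

theorem matrix_mul_eigenvectorMatrix (hc : ∀ j < n, c j ≠ 0)
    (hE : ∀ j, continuant a b c (n + 1) (E j) = 0) :
    matrix a b c (n + 1) * eigenvectorMatrix a b c E =
      eigenvectorMatrix a b c E * diagonal E := by
  ext i j
  rw [mul_apply, mul_diagonal]
  exact (sum_entry_mul_eigenvector hc (hE j) (Nat.le_of_lt_succ i.2)).trans (mul_comm _ _)

theorem sqNorm_pos (hpos : ∀ k ≤ n, 0 < Δ k) (j : Fin (n + 1)) : 0 < sqNorm a b c Δ E j := by
  refine sum_pos' (fun k _ => mul_nonneg (hpos k (by omega)).le (sq_nonneg _))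
    ⟨0, mem_univ _, ?_⟩
  rw [Fin.val_zero, eigenvector_zero, one_pow, mul_one]
  exact hpos 0 (Nat.zero_le n)

/-- By self-adjointness FᵀWF commutes with `diagonal E`; the entries of E being distinct, it must be
diagonal. -/
theorem transpose_mul_weight_mul_eigenvectorMatrix (hc : ∀ j < n, c j ≠ 0)
    (hΔ : ∀ k < n, Δ (k + 1) * a (k + 1) = Δ k * c k)
    (hE : ∀ j, continuant a b c (n + 1) (E j) = 0) (hinj : Function.Injective E) :
    (eigenvectorMatrix a b c E)ᵀ * diagonal (fun k : Fin (n + 1) => Δ k) *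
      eigenvectorMatrix a b c E = diagonal (sqNorm a b c Δ E) := by
  set F := eigenvectorMatrix a b c E with hF
  set W := diagonal fun k : Fin (n + 1) => Δ k with hW
  set T := matrix a b c (n + 1) with hT
  have hTF : T * F = F * diagonal E := matrix_mul_eigenvectorMatrix hc hE
  have hWT : W * T = Tᵀ * W := by
    ext i k
    rw [hW, hT, diagonal_mul, mul_diagonal, transpose_apply, matrix_apply, matrix_apply,
      weight_mul_entry hΔ (Nat.le_of_lt_succ i.2) (Nat.le_of_lt_succ k.2), mul_comm]
  have hcomm : diagonal E * (Fᵀ * W * F) = Fᵀ * W * F * diagonal E := by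
    have h := congrArg transpose hTF
    rw [transpose_mul, transpose_mul, diagonal_transpose] at h
    calc diagonal E * (Fᵀ * W * F) = Fᵀ * (Tᵀ * W) * F := by
          simp only [← Matrix.mul_assoc, h]
      _ = Fᵀ * W * (T * F) := by rw [← hWT]; simp only [Matrix.mul_assoc]
      _ = _ := by rw [hTF]; simp only [Matrix.mul_assoc]
  ext i j
  rcases eq_or_ne i j with rfl | hne
  · rw [diagonal_apply_eq, mul_apply, sqNorm]
    refine sum_congr rfl fun k _ => ?_
    rw [mul_diagonal, transpose_apply, hF, eigenvectorMatrix, of_apply]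
    ring
  · rw [diagonal_apply_ne _ hne]
    have h := congrFun (congrFun hcomm i) j
    rw [diagonal_mul, mul_diagonal] at h
    refine (mul_eq_zero.1 (?_ : (E i - E j) * _ = 0)).resolve_left
      (sub_ne_zero.2 (hinj.ne hne))
    linear_combination h

theorem inverse_mul_eigenvectorMatrix (hc : ∀ j < n, c j ≠ 0) (hpos : ∀ k ≤ n, 0 < Δ k)
    (hΔ : ∀ k < n, Δ (k + 1) * a (k + 1) = Δ k * c k)
    (hE : ∀ j, continuant a b c (n + 1) (E j) = 0) (hinj : Function.Injective E) :
    diagonal (fun j => (sqNorm a b c Δ E j)⁻¹) * (eigenvectorMatrix a b c E)ᵀ *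
      diagonal (fun k : Fin (n + 1) => Δ k) * eigenvectorMatrix a b c E = 1 := by
  rw [Matrix.mul_assoc, Matrix.mul_assoc, ← Matrix.mul_assoc _ᵀ,
    transpose_mul_weight_mul_eigenvectorMatrix hc hΔ hE hinj, diagonal_mul_diagonal,
    ← diagonal_one]
  exact congrArg diagonal (funext fun j => inv_mul_cancel₀ (sqNorm_pos hpos j).ne')

/-- The squared norm of an eigenvector in terms of the characteristic polynomial of the
complementary block. -/
theorem det_submatrix_succ_mul_sqNorm (hc : ∀ j < n, c j ≠ 0) (hpos : ∀ k ≤ n, 0 < Δ k)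
    (hΔ0 : Δ 0 = 1) (hΔ : ∀ k < n, Δ (k + 1) * a (k + 1) = Δ k * c k)
    (hE : ∀ j, continuant a b c (n + 1) (E j) = 0) (hinj : Function.Injective E)
    (j : Fin (n + 1)) :
    ((scalar (Fin (n + 1)) (E j) - matrix a b c (n + 1)).submatrix Fin.succ Fin.succ).det *
      sqNorm a b c Δ E j = ∏ l ∈ univ.erase j, (E j - E l) := by
  set F := eigenvectorMatrix a b c E with hF
  set W := diagonal fun k : Fin (n + 1) => Δ k with hW
  set T := matrix a b c (n + 1) with hT
  set d := sqNorm a b c Δ E with hd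
  set X := scalar (Fin (n + 1)) (E j) - T with hX
  set Y : Fin (n + 1) → ℝ := fun l => E j - E l with hY
  have hleft : diagonal (fun j => (d j)⁻¹) * Fᵀ * W * F = 1 :=
    inverse_mul_eigenvectorMatrix hc hpos hΔ hE hinj
  have hright := mul_eq_one_comm.1 hleft
  have hdetF : F.det ≠ 0 := fun h => by
    have := congrArg det hleft
    rw [det_mul, h, mul_zero, det_one] at this
    exact zero_ne_one this
  have hXF : X * F = F * diagonal Y := by
    have hYd : diagonal Y = scalar (Fin (n + 1)) (E j) - diagonal E := by
      rw [scalar_apply, diagonal_sub]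
    rw [hX, hYd, Matrix.sub_mul, Matrix.mul_sub, matrix_mul_eigenvectorMatrix hc hE,
      (scalar_commute (E j) (fun r => mul_comm _ r) F).eq]
  -- `X` is singular, so the diagonalisation is passed to adjugates, with the nonzero factor det F
  -- cancelled.
  have hadj : adjugate X * F = F * adjugate (diagonal Y) := by
    have h := congrArg adjugate hXF
    rw [adjugate_mul_distrib, adjugate_mul_distrib] at h
    have h2 : F.det • (adjugate X * F) = F.det • (F * adjugate (diagonal Y)) := by
      calc F.det • (adjugate X * F) = F * (adjugate F * adjugate X) * F := by
            rw [← Matrix.mul_assoc F, mul_adjugate, smul_mul, Matrix.one_mul, smul_mul]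
        _ = F * adjugate (diagonal Y) * (adjugate F * F) := by
            rw [h]; simp only [Matrix.mul_assoc]
        _ = _ := by rw [adjugate_mul, Matrix.mul_smul, Matrix.mul_one]
    exact smul_right_injective _ hdetF h2
  have hadj' : adjugate X =
      F * adjugate (diagonal Y) * (diagonal (fun j => (d j)⁻¹) * Fᵀ * W) := by
    rw [← hadj, Matrix.mul_assoc, hright, Matrix.mul_one]
  -- As Y j = 0, only the j-th diagonal entry of the adjugate of `diagonal Y` can survive. The first
  -- row of F is constantly 1 and Δ₀ = 1, so no other factors remain.
  have h00 := congrFun (congrFun hadj' 0) 0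
  have hFrow : ∀ k, F 0 k = 1 := fun k => eigenvector_zero _
  rw [adjugate_fin_succ_eq_det_submatrix, adjugate_diagonal, mul_apply,
    Finset.sum_eq_single j] at h00
  · rw [mul_diagonal, Matrix.mul_assoc, diagonal_mul, hW, mul_diagonal, transpose_apply, hFrow,
      Fin.val_zero, hΔ0, one_mul, mul_one, mul_one, add_zero, pow_zero, one_mul] at h00
    rw [show (Fin.succ : Fin n → Fin (n + 1)) = (0 : Fin (n + 1)).succAbove from
      (funext fun i => (Fin.succAbove_zero_apply i).symm), h00, mul_assoc,
      inv_mul_cancel₀ (sqNorm_pos hpos j).ne', mul_one]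
  · intro l _ hl
    rw [mul_diagonal, Finset.prod_eq_zero (mem_erase.2 ⟨hl.symm, mem_univ j⟩)
      (by rw [hY]; exact sub_self _), mul_zero, zero_mul]
  · exact fun h => absurd (mem_univ j) h

/-- Up to a row factor, row k evaluates a monic polynomial of degree k, so the determinant reduces
to a Vandermonde determinant. -/
theorem det_eigenvectorMatrix :
    (eigenvectorMatrix a b c E).det =
      (∏ k : Fin (n + 1), ∏ j ∈ range k, (c j)⁻¹) * ∏ i, ∏ j ∈ Ioi i, (E j - E i) := by
  rw [← det_vandermonde, det_eval_matrixOfPolynomials_eq_det_vandermonde E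
    (fun k : Fin (n + 1) => (matrix a b c k).charpoly)
    (fun k => (charpoly_natDegree_eq_dim _).trans (Fintype.card_fin _))
    (fun k => charpoly_monic _), ← det_transpose (Matrix.of _), ← det_mul_column]
  congr 1
  ext k j
  rw [of_apply, transpose_apply, of_apply, ← continuant_eq_eval_charpoly, mul_comm]
  rfl

/-- Each of the n(n+1)/2 factors is negative. -/
theorem prod_sub_eq_of_strictAnti (hE : StrictAnti E) :
    ∏ i, ∏ j ∈ Ioi i, (E j - E i) =
      (-1) ^ (n * (n + 1) / 2) * |∏ i, ∏ j ∈ Ioi i, (E j - E i)| := by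
  have hcard : ∑ i : Fin (n + 1), #(Ioi i) = n * (n + 1) / 2 := by
    have h : ∑ i : Fin (n + 1), #(Ioi i) = ∑ i ∈ range (n + 1), (n + 1 - 1 - i) := by
      rw [← Fin.sum_univ_eq_sum_range fun i => n + 1 - 1 - i]
      exact sum_congr rfl fun i _ => Fin.card_Ioi i
    rw [h, sum_range_reflect fun i => i, sum_range_id, Nat.add_sub_cancel, mul_comm]
  have hsign : ∀ i, ∏ j ∈ Ioi i, (E j - E i) =
      (-1) ^ #(Ioi i) * ∏ j ∈ Ioi i, |E j - E i| := by
    intro i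
    rw [← prod_const, ← prod_mul_distrib]
    refine prod_congr rfl fun j hj => ?_
    rw [abs_of_neg (sub_neg.2 (hE (mem_Ioi.1 hj))), neg_one_mul, neg_neg]
  simp only [abs_prod]
  rw [← hcard, ← prod_pow_eq_pow_sum, ← prod_mul_distrib]
  exact prod_congr rfl fun i _ => hsign i

theorem det_eigenvectorMatrix_eq_sqrt (hc : ∀ j < n, 0 < c j) (hpos : ∀ k ≤ n, 0 < Δ k)
    (hΔ : ∀ k < n, Δ (k + 1) * a (k + 1) = Δ k * c k)
    (hE : ∀ j, continuant a b c (n + 1) (E j) = 0) (hanti : StrictAnti E) :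
    (eigenvectorMatrix a b c E).det =
      (-1) ^ (n * (n + 1) / 2) * ∏ l : Fin (n + 1), √(sqNorm a b c Δ E l / Δ l) := by
  have habs : (eigenvectorMatrix a b c E).det =
      (-1) ^ (n * (n + 1) / 2) * |(eigenvectorMatrix a b c E).det| := by
    have h : 0 ≤ ∏ k : Fin (n + 1), ∏ j ∈ range k, (c j)⁻¹ :=
      prod_nonneg fun k _ => prod_nonneg fun j hj =>
        (inv_pos.2 (hc j (by have := mem_range.1 hj; omega))).le
    rw [det_eigenvectorMatrix, abs_mul, abs_of_nonneg h, mul_left_comm,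
      ← prod_sub_eq_of_strictAnti hanti]
  rw [habs]
  congr 1
  have hsq := congrArg det (transpose_mul_weight_mul_eigenvectorMatrix
    (fun j hj => (hc j hj).ne') hΔ hE hanti.injective)
  rw [det_mul, det_mul, det_transpose, det_diagonal, det_diagonal] at hsq
  have hΔpos : ∀ k : Fin (n + 1), 0 < Δ k := fun k => hpos k (Nat.le_of_lt_succ k.2)
  rw [← Real.sqrt_prod _ fun l _ => div_nonneg (sqNorm_pos hpos l).le (hΔpos l).le,
    ← Real.sqrt_sq_eq_abs, prod_div_distrib]
  congr 1
  rw [eq_div_iff (prod_pos fun k _ => hΔpos k).ne']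
  linear_combination hsq

end Tridiagonal

/-! ### Weights and the complementary minor of the Heun matrix -/

namespace HeunParams

open Finset Matrix

variable {P : HeunParams}

theorem weight_zero (P : HeunParams) : P.weight 0 = 1 := by
  rw [weight, Icc_eq_empty (by norm_num), prod_empty]

theorem Admissible.weight_pos (hP : P.Admissible) {k : ℕ} (hk : k ≤ P.M) : 0 < P.weight k :=
  prod_pos fun l hl => by
    obtain ⟨h1, h2⟩ := mem_Icc.1 hl
    exact div_pos (hP.aTilde_pos (by omega) (by omega)) (hP.a_pos h1 (by omega))

theorem Admissible.weight_succ_mul (hP : P.Admissible) {k : ℕ} (hk : k < P.M) :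
    P.weight (k + 1) * P.a (k + 1) = P.weight k * P.aTilde (P.M - k) := by
  rw [weight, prod_Icc_succ_top (by omega), Nat.add_sub_add_right, mul_assoc,
    div_mul_cancel₀ _ (hP.a_pos (by omega) (by omega)).ne']
  rfl

/-- The exchange of parameters gives the characteristic polynomial of the lower right block. -/
theorem Admissible.perm2_racah (hP : P.Admissible) (x : ℝ) :
    P.perm2.racah P.M x =
      ((scalar (Fin (P.M + 1)) x - P.H).submatrix Fin.succ Fin.succ).det := by
  -- Reversing the indices 0, …, M-1 by i ↦ M-1-i and then applying the reversal i ↦ M-i of `H`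
  -- shifts every index by one, which selects rows and columns 1, …, M.
  rw [racah, ← det_submatrix_equiv_self Fin.revPerm]
  congr 1
  ext i j
  have hsub : ∀ i : Fin P.M, P.M - (Fin.rev i : ℕ) = i + 1 := fun i => by
    rw [Fin.val_rev]; omega
  simp only [submatrix_apply, of_apply, Fin.revPerm_apply, Fin.rev_inj]
  rw [hP.perm2_entry (Fin.rev i).2.le (Fin.rev j).2.le, hsub, hsub, Matrix.sub_apply,
    scalar_apply, diagonal_apply]
  simp only [Fin.succ_inj]
  rfl

end HeunParams

/-- The decreasing enumeration is the unique increasing enumeration of a finite set, read backwards.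
-/
theorem exists_unique_strictAnti_range_eq {n : ℕ} {s : Set ℝ} {e : Fin n → ℝ}
    (he : Function.Injective e) (hs : Set.range e = s) :
    ∃! E : Fin n → ℝ, StrictAnti E ∧ Set.range E = s := by
  classical
  have hcard : (Finset.univ.image e).card = n := by
    rw [Finset.card_image_of_injective _ he, Finset.card_univ, Fintype.card_fin]
  have hcomp : ∀ f : Fin n → ℝ, Set.range (f ∘ Fin.rev) = Set.range f := fun f =>
    Fin.rev_surjective.range_comp f
  refine ⟨(Finset.univ.image e).orderEmbOfFin hcard ∘ Fin.rev,
    ⟨((Finset.univ.image e).orderEmbOfFin hcard).strictMono.comp_strictAnti Fin.rev_strictAnti,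
      ?_⟩, fun E hE => ?_⟩
  · rw [hcomp, Finset.range_orderEmbOfFin, Finset.coe_image, Finset.coe_univ, Set.image_univ, hs]
  · have h := Finset.orderEmbOfFin_unique hcard (f := E ∘ Fin.rev)
      (fun x => by
        rw [← Finset.mem_coe, Finset.coe_image, Finset.coe_univ, Set.image_univ, hs, ← hE.2]
        exact ⟨_, rfl⟩) (hE.1.comp Fin.rev_strictAnti)
    rw [← h]
    funext i
    simp

end EllipticRacah

theorem corollary3p5 (P : EllipticRacah.HeunParams) (hP : P.Admissible) :
    (∃! E : Fin (P.M + 1) → ℝ, P.IsOrderedSpectrum E) ∧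
    ∀ E : Fin (P.M + 1) → ℝ, P.IsOrderedSpectrum E →
      (∀ l : Fin (P.M + 1), 0 < P.norm E l ∧ 0 < P.weight l) ∧
      IsUnit (P.F E) ∧
      (P.F E)⁻¹ = (P.normMatrix E)⁻¹ * (P.F E).transpose * P.weightMatrix ∧
      (P.F E).det = (-1) ^ (P.M * (P.M + 1) / 2) *
        ∏ l : Fin (P.M + 1), Real.sqrt (P.norm E l / P.weight l) := by
  -- Only the values for j < M are matrix entries; at j = M this would be ã₀, whose sign is not
  -- controlled.
  set c : ℕ → ℝ := fun j => P.aTilde (P.M - j) with hcdef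
  have hc : ∀ j < P.M, 0 < c j := fun j hj => hP.aTilde_pos (by omega) (by omega)
  have hc' : ∀ j < P.M, c j ≠ 0 := fun j hj => (hc j hj).ne'
  have hpos : ∀ k ≤ P.M, 0 < P.weight k := fun k hk => hP.weight_pos hk
  have hΔ : ∀ k < P.M, P.weight (k + 1) * P.a (k + 1) = P.weight k * c k := fun k hk =>
    hP.weight_succ_mul hk
  have hH : P.H = EllipticRacah.Tridiagonal.matrix P.a P.b c (P.M + 1) := rfl
  obtain ⟨e, he, hrange⟩ :=
    EllipticRacah.Tridiagonal.exists_injective_range_eq_spectrum (b := P.b) hc' hpos hΔ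
  refine ⟨EllipticRacah.exists_unique_strictAnti_range_eq he (hrange.trans (by rw [hH])),
    fun E hE => ?_⟩
  have hinj : Function.Injective E := hE.1.injective
  have hroot : ∀ j, EllipticRacah.Tridiagonal.continuant P.a P.b c (P.M + 1) (E j) = 0 := fun j =>
    EllipticRacah.Tridiagonal.mem_spectrum_iff.1 (hE.2 ▸ Set.mem_range_self j)
  have hF : P.F E = EllipticRacah.Tridiagonal.eigenvectorMatrix P.a P.b c E := rfl
  -- The product a₁⋯a_M cancels, so N_j is the modulus of ∏_{l≠j}(E_j - E_l)/p̃_M(E_j), and this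
  -- quotient is the positive squared norm. The denominator is nonzero because the eigenvalues are
  -- distinct.
  have hnorm : P.norm E = EllipticRacah.Tridiagonal.sqNorm P.a P.b c P.weight E := by
    funext j
    have hprod := EllipticRacah.Tridiagonal.det_submatrix_succ_mul_sqNorm hc' hpos
      P.weight_zero hΔ hroot hinj j
    have hsq := EllipticRacah.Tridiagonal.sqNorm_pos (a := P.a) (b := P.b) (c := c) (E := E) hpos j
    rw [← hH, ← hP.perm2_racah] at hprod
    have ha : 0 < ∏ k ∈ Finset.Icc 1 P.M, P.a k := Finset.prod_pos fun k hk =>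
      hP.a_pos (Finset.mem_Icc.1 hk).1 (Finset.mem_Icc.1 hk).2
    have hne : P.perm2.racah P.M (E j) ≠ 0 := fun h => by
      rw [h, zero_mul, eq_comm, Finset.prod_eq_zero_iff] at hprod
      obtain ⟨l, hl, h0⟩ := hprod
      exact (Finset.mem_erase.1 hl).1 (hinj (sub_eq_zero.1 h0)).symm
    rw [EllipticRacah.HeunParams.norm, EllipticRacah.HeunParams.eps, ← Finset.abs_prod,
      ← hprod, abs_div, abs_of_pos ha,
      div_mul_cancel₀ _ ha.ne', abs_mul, abs_of_pos hsq, ← mul_assoc, one_div,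
      inv_mul_cancel₀ (abs_ne_zero.2 hne), one_mul]
  have hinv := EllipticRacah.Tridiagonal.inverse_mul_eigenvectorMatrix hc' hpos hΔ hroot hinj
  have hN : (P.normMatrix E)⁻¹ =
      Matrix.diagonal fun j => (EllipticRacah.Tridiagonal.sqNorm P.a P.b c P.weight E j)⁻¹ := by
    refine Matrix.inv_eq_left_inv ?_
    rw [EllipticRacah.HeunParams.normMatrix, hnorm, Matrix.diagonal_mul_diagonal,
      ← Matrix.diagonal_one]
    exact congrArg Matrix.diagonal (funext fun j =>
      inv_mul_cancel₀ (EllipticRacah.Tridiagonal.sqNorm_pos hpos j).ne')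
  refine ⟨fun l => ⟨hnorm ▸ EllipticRacah.Tridiagonal.sqNorm_pos hpos l, hpos l (by omega)⟩,
    ?_, ?_, ?_⟩
  · exact IsUnit.of_mul_eq_one_right _ hinv
  · rw [hN]
    exact Matrix.inv_eq_left_inv hinv
  · rw [hnorm, hF, EllipticRacah.Tridiagonal.det_eigenvectorMatrix_eq_sqrt hc hpos hΔ hroot hE.1]
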